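/- Let $a,b:[0,\infty)\to\mathbb R$ be Lebesgue measurable and essentially bounded with $a(t)\ge b(t)\ge 0$, and let $h,g:[0,\infty)\to\mathbb R$ be Lebesgue measurable with $0\le t-h(t)\le\tau$ and $0\le t-g(t)\le\delta$ for all $t\ge 0$, where $\tau,\delta$ are finite constants. Put $r=\max\{\delta,\tau\}$ and consider the equation $$\dot x(t)+a(t)x(h(t))-b(t)x(g(t))=0. \qquad (1)$$ For $t_0\ge 0$ and a bounded Borel measurable function $\varphi:[t_0-r,t_0]\to\mathbb R$, a solution of (1) with initial data $(t_0,\varphi)$ is a function $x$ on $[t_0-r,\infty)$ that is locally absolutely continuous on $[t_0,\infty)$, satisfies (1) for almost every $t\ge t_0$, and equals $\varphi$ on $[t_0-r,t_0]$. Equation (1) is called *asymptotically stable* if for every $t_0\ge 0$: for each $\varepsilon>0$ there is $\eta>0$ such that $\sup_{[t_0-r,t_0]}|\varphi|<\eta$ implies $|x(t)|<\varepsilon$ for all $t\ge t_0$, and $\lim_{t\to\infty}x(t)=0$ for every solution $x$ with initial point $t_0$ (with arbitrary $\varphi$). It is called *uniformly exponentially stable* if there are $M,\gamma>0$, independent of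 $t_0$ and $\varphi$, such that $|x(t)|\le Me^{-\gamma(t-t_0)}\sup_{[t_0-r,t_0]}|\varphi|$ for all $t_0\ge0$, all $\varphi$, and all $t\ge t_0$. For $t_0\ge 0$ let $\|f\|_{[t_0,\infty)}=\operatorname{ess\,sup}_{t\ge t_0}|f(t)|\in[0,\infty]$ (with $0\cdot\infty=0$), and $u^+=\max\{u,0\}$; in integrals whose limits may be negative, $a$ and $b$ are extended by $0$ to $(-\infty,0)$. Assume that $a(t)-b(t)\ne 0$ for almost every $t\ge 0$, that $\int_0^\infty[a(s)-b(s)]\,ds=\infty$, and that for some $t_0\ge 0$ $$\left\|\left(\int_{h(\cdot)}^{\,\cdot}[a(s)-b(s)]\,ds-\frac1e\right)^{+}\right\|_{[t_0,\infty)}+2\left\|\frac{b}{a-b}\right\|_{[t_0,\infty)}\left\|\int_{h(\cdot)}^{g(\cdot)}[a(s)-b(s)]\,ds\right\|_{[t_0,\infty)}<1.$$ Then equation (1) is asymptotically stable. If in addition there exists $T>0$ such that $$\liminf_{t\to\infty}\int_t^{t+T}[a(s)-b(s)]\,ds>0,$$ then equation (1) is uniformly exponentially stable. -/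

import Mathlib

open MeasureTheory Filter Topology Set
open scoped ENNReal

/-- `x` solves the initial value problem
`x'(t) + a(t) x(h(t)) - b(t) x(g(t)) = 0` for `t ≥ t₀`, `x(t) = φ(t)` for `t ∈ [t₀ - r, t₀]`:
it is locally absolutely continuous on `[t₀, ∞)`, satisfies the equation for almost every
`t ≥ t₀`, and agrees with `φ` on the initial interval (so that `x(t₀) = φ(t₀)`). -/
structure IsDelaySolution (a b h g : ℝ → ℝ) (r t₀ : ℝ) (φ x : ℝ → ℝ) : Prop where
  absCont : ∀ t₁, t₀ ≤ t₁ → AbsolutelyContinuousOnInterval x t₀ t₁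
  equation : ∀ᵐ t ∂(volume.restrict (Ici t₀)),
    ∃ x' : ℝ, HasDerivAt x x' t ∧ x' + a t * x (h t) - b t * x (g t) = 0
  initial : ∀ t ∈ Icc (t₀ - r) t₀, x t = φ t

/-- Admissible initial functions: Borel measurable and bounded on `[t₀ - r, t₀]`. -/
structure IsInitialFunction (r t₀ : ℝ) (φ : ℝ → ℝ) : Prop where
  measurable : Measurable ((Icc (t₀ - r) t₀).domRestrict φ)
  bounded : ∃ C : ℝ, ∀ t ∈ Icc (t₀ - r) t₀, |φ t| ≤ C

/-- `sup_{t ∈ [t₀ - r, t₀]} |φ(t)|`. -/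
noncomputable def initialSup (r t₀ : ℝ) (φ : ℝ → ℝ) : ℝ :=
  sSup ((fun t => |φ t|) '' Icc (t₀ - r) t₀)

/-- Asymptotic stability of `x'(t) + a(t) x(h(t)) - b(t) x(g(t)) = 0`, whose delays are at most
`r`: for every initial point `t₀ ≥ 0` the zero solution is stable, and all solutions tend to
zero. -/
def AsymptoticallyStable (a b h g : ℝ → ℝ) (r : ℝ) : Prop :=
  ∀ t₀ : ℝ, 0 ≤ t₀ →
    (∀ ε : ℝ, 0 < ε → ∃ η : ℝ, 0 < η ∧ ∀ φ x : ℝ → ℝ,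
      IsInitialFunction r t₀ φ → IsDelaySolution a b h g r t₀ φ x →
        initialSup r t₀ φ < η → ∀ t, t₀ ≤ t → |x t| < ε) ∧
    (∀ φ x : ℝ → ℝ,
      IsInitialFunction r t₀ φ → IsDelaySolution a b h g r t₀ φ x → Tendsto x atTop (𝓝 0))

/-- Uniform exponential stability of `x'(t) + a(t) x(h(t)) - b(t) x(g(t)) = 0`, whose delays are
at most `r`: `M` and `γ` depend neither on `t₀` nor on `φ`. -/
def UniformlyExponentiallyStable (a b h g : ℝ → ℝ) (r : ℝ) : Prop :=
  ∃ M γ : ℝ, 0 < M ∧ 0 < γ ∧ ∀ t₀ : ℝ, 0 ≤ t₀ → ∀ φ x : ℝ → ℝ,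
    IsInitialFunction r t₀ φ → IsDelaySolution a b h g r t₀ φ x →
      ∀ t, t₀ ≤ t → |x t| ≤ M * Real.exp (-γ * (t - t₀)) * initialSup r t₀ φ

/-- The essential supremum norm `‖f‖_{[t₀, ∞)}`, with values in `[0, ∞]`. -/
noncomputable def essNorm (t₀ : ℝ) (f : ℝ → ℝ) : ℝ≥0∞ :=
  eLpNorm f ∞ (volume.restrict (Ici t₀))

/-- `∫_u^v [a(s) - b(s)] ds`, where the coefficients, which are given on `[0, ∞)`, are extended
by zero to the negative half-line. -/
noncomputable def netIntegral (a b : ℝ → ℝ) (u v : ℝ) : ℝ :=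
  ∫ s in (max u 0)..(max v 0), (a s - b s)

/-!
# Stability of `x'(t) + a(t) x(h(t)) - b(t) x(g(t)) = 0`

Put `c = a - b` and measure time by the clock `σ(t) = ∫_0^t c`. The equation becomes
`x' = -c x(h) - b (x(h) - x(g))`, a perturbation of a delay equation with coefficient `1` on the
clock. Let `A` be the essential supremum of the part of the delay of `h` that exceeds `1/e` on the
clock, and `B` the product of those of `b / c` and of the clock distance between `h` and `g`; the
assumption is `A + 2B < 1`.

If the delay is at most `1/e` on the clock, then the equation does not oscillate: supersolutions
with suitable initial data stay nonnegative (`IsClock.nonneg_of_delay_supersolution`). Comparing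
with `F + K e^{-σ}`, one finds that a solution of `x' + c x(k) = f` with `|f| ≤ F c` is bounded by
`F`, up to a decaying transient (`IsClock.abs_le_of_short_delay`).

Let `D` be a Lipschitz constant of the solution with respect to the clock, and `Y` a bound of it.
Shortening the delay of `h` to `1/e` costs `A D c`, and the term with `b` costs `B D c`; hence
`Y ≤ (A + B) D` up to transients. Read directly, the equation gives `D ≤ Y + B D`. Together,
`D ≤ (A + 2B) D` up to transients. This yields a uniform bound (`ClockEquation.bounded`), and,
applied to the tails of the solution, geometric decay of both `Y` and `D` after each fixed amount of
clock time (`ClockEquation.contraction`). Therefore all solutions decay like `e^{-γ σ}`, with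
constants independent of the initial data (`exists_clock_exponential_estimate`). Asymptotic
stability follows since `σ → ∞`, and uniform exponential stability since the last hypothesis makes
`σ` grow at least linearly (`linear_lower_bound_of_step`).
-/

/-! ### Comparison through almost everywhere derivatives -/

theorem AbsolutelyContinuousOnInterval.le_of_ae_deriv_nonpos {f : ℝ → ℝ} {p q : ℝ} (hpq : p ≤ q)
    (hf : AbsolutelyContinuousOnInterval f p q)
    (hd : ∀ᵐ t, t ∈ Icc p q → ∃ f' : ℝ, HasDerivAt f f' t ∧ f' ≤ 0) : f q ≤ f p := by
  have h1 := hf.integral_deriv_eq_sub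
  have h2 : 0 ≤ ∫ t in p..q, -deriv f t := by
    refine intervalIntegral.integral_nonneg_of_ae_restrict hpq ?_
    rw [EventuallyLE, ae_restrict_iff' measurableSet_Icc]
    filter_upwards [hd] with t ht htm
    obtain ⟨f', hf', h0⟩ := ht htm
    simpa [hf'.deriv] using h0
  rw [intervalIntegral.integral_neg] at h2
  linarith

/-- The mean value inequality for absolutely continuous functions, the bound being an
absolutely continuous function as well. -/
theorem AbsolutelyContinuousOnInterval.abs_sub_le_of_ae_deriv_le {f G : ℝ → ℝ} {p q : ℝ}
    (hpq : p ≤ q) (hf : AbsolutelyContinuousOnInterval f p q)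
    (hG : AbsolutelyContinuousOnInterval G p q)
    (hd : ∀ᵐ t, t ∈ Icc p q → ∃ f' G' : ℝ, HasDerivAt f f' t ∧ HasDerivAt G G' t ∧ |f'| ≤ G') :
    |f q - f p| ≤ G q - G p := by
  have h1 := (hf.fun_sub hG).le_of_ae_deriv_nonpos hpq (by
    filter_upwards [hd] with t ht htm
    obtain ⟨f', G', h1, h2, h3⟩ := ht htm
    exact ⟨_, h1.fun_sub h2, by linarith [le_abs_self f']⟩)
  have h2 := (hf.fun_neg.fun_sub hG).le_of_ae_deriv_nonpos hpq (by
    filter_upwards [hd] with t ht htm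
    obtain ⟨f', G', h1, h2, h3⟩ := ht htm
    exact ⟨_, h1.fun_neg.fun_sub h2, by linarith [neg_le_abs f']⟩)
  rw [abs_le]
  constructor <;> linarith

/-! ### The intrinsic clock -/

/-- `σ` is a primitive of the essentially bounded weight `c ≥ 0`. It plays the role of a new time
variable in which the equation `x'(t) + c(t) x(h(t)) = 0` has the constant coefficient `1`. -/
structure IsClock (σ c : ℝ → ℝ) (α : ℝ) : Prop where
  nonneg : ∀ t, 0 ≤ c t
  mono : Monotone σ
  lip : ∀ u v, u ≤ v → σ v - σ u ≤ α * (v - u)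
  deriv : ∀ᵐ t, HasDerivAt σ (c t) t

/-- `x` is Lipschitz on `s` with constant `D` when time is measured by the clock `σ`. -/
def ClockLipschitzOn (σ x : ℝ → ℝ) (D : ℝ) (s : Set ℝ) : Prop :=
  ∀ ⦃u⦄, u ∈ s → ∀ ⦃v⦄, v ∈ s → u ≤ v → |x v - x u| ≤ D * (σ v - σ u)

namespace IsClock

variable {σ c : ℝ → ℝ} {α : ℝ}

theorem bound_nonneg (hσ : IsClock σ c α) : 0 ≤ α := by
  have h1 := hσ.lip 0 1 zero_le_one
  have h2 := hσ.mono (zero_le_one (α := ℝ))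
  linarith

theorem lipschitzWith (hσ : IsClock σ c α) : LipschitzWith α.toNNReal σ := by
  refine LipschitzWith.of_le_add_mul _ fun u v => ?_
  rw [Real.coe_toNNReal _ hσ.bound_nonneg, Real.dist_eq]
  rcases le_total u v with h | h
  · have := hσ.mono h
    have := mul_nonneg hσ.bound_nonneg (abs_nonneg (u - v))
    linarith
  · have := hσ.lip v u h
    rw [abs_of_nonneg (by linarith)]
    linarith

theorem continuous (hσ : IsClock σ c α) : Continuous σ := hσ.lipschitzWith.continuous

theorem absolutelyContinuous (hσ : IsClock σ c α) (p q : ℝ) :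
    AbsolutelyContinuousOnInterval σ p q :=
  (hσ.lipschitzWith.lipschitzOnWith (s := uIcc p q)).absolutelyContinuousOnInterval

theorem absolutelyContinuous_exp_neg_mul (hσ : IsClock σ c α) {k : ℝ} (hk : 0 ≤ k) {p q : ℝ}
    (hpq : p ≤ q) : AbsolutelyContinuousOnInterval (fun t => Real.exp (-(k * σ t))) p q := by
  have key : ∀ u ∈ Icc p q, ∀ v, u ≤ v →
      |Real.exp (-(k * σ u)) - Real.exp (-(k * σ v))|
        ≤ Real.exp (-(k * σ p)) * (k * α) * |u - v| := by
    intro u hu v huv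
    have h0 : σ u ≤ σ v := hσ.mono huv
    have h1 : Real.exp (-(k * σ v)) = Real.exp (-(k * σ u)) * Real.exp (-(k * (σ v - σ u))) := by
      rw [← Real.exp_add]; ring_nf
    have h2 := Real.add_one_le_exp (-(k * (σ v - σ u)))
    have h3 : Real.exp (-(k * σ v)) ≤ Real.exp (-(k * σ u)) :=
      Real.exp_le_exp.2 (by nlinarith)
    have h4 : Real.exp (-(k * σ u)) ≤ Real.exp (-(k * σ p)) :=
      Real.exp_le_exp.2 (by nlinarith [hσ.mono hu.1])
    have h5 : k * (σ v - σ u) ≤ k * α * (v - u) := by nlinarith [hσ.lip u v huv]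
    rw [abs_of_nonneg (by linarith), abs_sub_comm u v, abs_of_nonneg (by linarith : 0 ≤ v - u)]
    calc Real.exp (-(k * σ u)) - Real.exp (-(k * σ v))
        ≤ Real.exp (-(k * σ u)) * (k * (σ v - σ u)) := by
          rw [h1]; nlinarith [Real.exp_pos (-(k * σ u))]
      _ ≤ Real.exp (-(k * σ p)) * (k * α * (v - u)) := by
          refine mul_le_mul h4 h5 (mul_nonneg hk (by linarith)) (Real.exp_pos _).le
      _ = _ := by ring
  have hK : 0 ≤ Real.exp (-(k * σ p)) * (k * α) :=
    mul_nonneg (Real.exp_pos _).le (mul_nonneg hk hσ.bound_nonneg)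
  refine LipschitzOnWith.absolutelyContinuousOnInterval
    (K := (Real.exp (-(k * σ p)) * (k * α)).toNNReal) ?_
  refine LipschitzOnWith.of_dist_le_mul fun u hu v hv => ?_
  rw [uIcc_of_le hpq] at hu hv
  rw [Real.coe_toNNReal _ hK, Real.dist_eq, Real.dist_eq]
  rcases le_total u v with h | h
  · exact key u hu v h
  · rw [abs_sub_comm, abs_sub_comm u v]
    exact key v hv u h

theorem clockLipschitzOn (hσ : IsClock σ c α) {x : ℝ → ℝ} {D p q : ℝ}
    (hx : AbsolutelyContinuousOnInterval x p q)
    (hd : ∀ᵐ t, t ∈ Icc p q → ∃ x' : ℝ, HasDerivAt x x' t ∧ |x'| ≤ D * c t) :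
    ClockLipschitzOn σ x D (Icc p q) := by
  intro u hu v hv huv
  have hsub : uIcc u v ⊆ uIcc p q := by
    rw [uIcc_of_le huv, uIcc_of_le (hu.1.trans hu.2)]
    exact Icc_subset_Icc hu.1 hv.2
  have := (hx.mono hsub).abs_sub_le_of_ae_deriv_le huv
    ((hσ.absolutelyContinuous u v).const_mul D) (by
      filter_upwards [hd, hσ.deriv] with t ht hs htm
      obtain ⟨x', h1, h2⟩ := ht ⟨hu.1.trans htm.1, htm.2.trans hv.2⟩
      exact ⟨x', _, h1, hs.const_mul D, h2⟩)
  linarith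

end IsClock

namespace ClockLipschitzOn

variable {σ x : ℝ → ℝ} {D D' : ℝ} {s t : Set ℝ}

theorem subset (h : ClockLipschitzOn σ x D s) (hts : t ⊆ s) : ClockLipschitzOn σ x D t :=
  fun _ hu _ hv huv => h (hts hu) (hts hv) huv

theorem mono_const (h : ClockLipschitzOn σ x D s) (hσ : Monotone σ) (hD : D ≤ D') :
    ClockLipschitzOn σ x D' s := fun _ hu _ hv huv =>
  (h hu hv huv).trans (mul_le_mul_of_nonneg_right hD (sub_nonneg.2 (hσ huv)))

theorem abs_sub_le (h : ClockLipschitzOn σ x D s) (hσ : Monotone σ) {u v : ℝ} (hu : u ∈ s)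
    (hv : v ∈ s) : |x u - x v| ≤ D * |σ u - σ v| := by
  rcases le_total u v with huv | huv
  · rw [abs_sub_comm, abs_sub_comm (σ u), abs_of_nonneg (sub_nonneg.2 (hσ huv))]
    exact h hu hv huv
  · rw [abs_of_nonneg (sub_nonneg.2 (hσ huv))]
    exact h hv hu huv

theorem append {p q r : ℝ} (h₁ : ClockLipschitzOn σ x D (Icc p q))
    (h₂ : ClockLipschitzOn σ x D (Icc q r)) : ClockLipschitzOn σ x D (Icc p r) := by
  intro u hu v hv huv
  rcases le_total v q with hvq | hvq
  · exact h₁ ⟨hu.1, huv.trans hvq⟩ ⟨hv.1, hvq⟩ huv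
  rcases le_total q u with huq | huq
  · exact h₂ ⟨huq, hu.2⟩ ⟨hvq, hv.2⟩ huv
  have e1 := h₁ ⟨hu.1, huq⟩ ⟨hu.1.trans huq, le_rfl⟩ huq
  have e2 := h₂ ⟨le_rfl, hvq.trans hv.2⟩ ⟨hvq, hv.2⟩ hvq
  have := _root_.abs_sub_le (x v) (x q) (x u)
  linarith

end ClockLipschitzOn

/-! ### Equations with delay at most `1/e` -/

/-- Positivity for supersolutions of `u' + c(t) u(k(t)) = 0` whose delay is at most `1/e` on the
clock. If `W = u e^{eσ}` has maximum `m` over `[p, S]` at `z`, then the past values satisfy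
`u(k) ≤ m e^{-eσ(k)} ≤ e m e^{-eσ(t)}`, so that `m e^{-eσ} - u` has nonpositive derivative; being
zero at `z`, it is nonpositive at `S`, and `u` is nonnegative there. -/
theorem IsClock.nonneg_of_delay_supersolution {σ c u : ℝ → ℝ} {α w p S : ℝ}
    (hσ : IsClock σ c α) (hpS : p ≤ S)
    (hu : AbsolutelyContinuousOnInterval u p S)
    (hd : ∀ᵐ t, t ∈ Icc p S → ∃ u' k : ℝ, HasDerivAt u u' t ∧ w ≤ k ∧ k ≤ t ∧
      σ t - σ k ≤ 1 / Real.exp 1 ∧ 0 ≤ u' + c t * u k)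
    (hist : ∀ θ ∈ Icc w p,
      u θ * Real.exp (Real.exp 1 * σ θ) ≤ u p * Real.exp (Real.exp 1 * σ p))
    (hup : 0 ≤ u p) : 0 ≤ u S := by
  have hcont : ContinuousOn (fun t => u t * Real.exp (Real.exp 1 * σ t)) (Icc p S) := by
    have h1 := hu.continuousOn
    rw [uIcc_of_le hpS] at h1
    have h2 := hσ.continuous
    exact h1.mul (by fun_prop)
  obtain ⟨z, hz, hzmax⟩ := isCompact_Icc.exists_isMaxOn ⟨p, left_mem_Icc.2 hpS⟩ hcont
  set m : ℝ := u z * Real.exp (Real.exp 1 * σ z) with hm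
  have hmp : u p * Real.exp (Real.exp 1 * σ p) ≤ m := hzmax (left_mem_Icc.2 hpS)
  have hm0 : 0 ≤ m := (mul_nonneg hup (Real.exp_pos _).le).trans hmp
  have hle : ∀ k, w ≤ k → k ≤ S → u k ≤ m * Real.exp (-(Real.exp 1 * σ k)) := by
    intro k hk1 hk2
    have : u k * Real.exp (Real.exp 1 * σ k) ≤ m := by
      rcases le_total k p with h | h
      · exact (hist k ⟨hk1, h⟩).trans hmp
      · exact hzmax (show k ∈ Icc p S from ⟨h, hk2⟩)
    rw [Real.exp_neg, ← div_eq_mul_inv, le_div_iff₀ (Real.exp_pos _)]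
    exact this
  have hsub : uIcc z S ⊆ uIcc p S := by
    rw [uIcc_of_le hz.2, uIcc_of_le hpS]
    exact Icc_subset_Icc_left hz.1
  have hfin := (((hσ.absolutelyContinuous_exp_neg_mul (Real.exp_pos 1).le hz.2).const_mul m).fun_sub
    (hu.mono hsub)).le_of_ae_deriv_nonpos hz.2 (by
      filter_upwards [hd, hσ.deriv] with t ht hs htm
      obtain ⟨u', k, h1, h2, h3, h4, h5⟩ := ht ⟨hz.1.trans htm.1, htm.2⟩
      refine ⟨_, (((hs.const_mul (Real.exp 1)).fun_neg.exp).const_mul m).fun_sub h1, ?_⟩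
      have e1 := hle k h2 (h3.trans htm.2)
      have e2 : Real.exp (-(Real.exp 1 * σ k)) ≤ Real.exp 1 * Real.exp (-(Real.exp 1 * σ t)) := by
        rw [← Real.exp_add]
        refine Real.exp_le_exp.2 ?_
        rw [le_div_iff₀ (Real.exp_pos 1)] at h4
        linarith
      have e3 : c t * u k ≤ c t * (m * (Real.exp 1 * Real.exp (-(Real.exp 1 * σ t)))) :=
        mul_le_mul_of_nonneg_left (e1.trans (mul_le_mul_of_nonneg_left e2 hm0)) (hσ.nonneg t)
      linarith)
  have hz0 : m * Real.exp (-(Real.exp 1 * σ z)) = u z := by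
    rw [hm, mul_assoc, ← Real.exp_add, add_neg_cancel, Real.exp_zero, mul_one]
  have := mul_nonneg hm0 (Real.exp_pos (-(Real.exp 1 * σ S))).le
  linarith

/-- The elementary inequality that makes the comparison function of
`IsClock.le_of_short_delay` admissible on the initial interval. -/
theorem exp_history_inequality {F D₀ X₀ y y₀ d : ℝ} (hF : 0 ≤ F) (hD₀ : 0 ≤ D₀) (hd : 0 ≤ d)
    (hy : |y| ≤ X₀) (hyd : |y - y₀| ≤ D₀ * d) :
    F + (2 * X₀ + D₀) * Real.exp d - y₀
      ≤ Real.exp (Real.exp 1 * d) * (F + (2 * X₀ + D₀) - y) := by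
  have hX₀ : 0 ≤ X₀ := (abs_nonneg y).trans hy
  have he : (2 : ℝ) ≤ Real.exp 1 := by linarith [Real.add_one_le_exp 1]
  have h1 : d + 1 ≤ Real.exp d := Real.add_one_le_exp d
  have h2 : Real.exp d * Real.exp d ≤ Real.exp (Real.exp 1 * d) := by
    rw [← Real.exp_add]
    exact Real.exp_le_exp.2 (by nlinarith)
  set E := Real.exp d
  set G := Real.exp (Real.exp 1 * d)
  have h3 : E * (E - 1) ≤ G - E := by linarith
  have h4 : E - 1 ≤ G - E := by nlinarith
  have h5 := abs_le.1 hy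
  have h6 := abs_le.1 hyd
  have h7 : 0 ≤ F * (G - 1) := mul_nonneg hF (by linarith)
  have h8 : y * (G - 1) ≤ X₀ * (G - 1) := mul_le_mul_of_nonneg_right h5.2 (by linarith)
  have h9 : X₀ * (G - 1) ≤ X₀ * (2 * (G - E)) := mul_le_mul_of_nonneg_left (by linarith) hX₀
  have h10 : D₀ * d ≤ D₀ * (G - E) := mul_le_mul_of_nonneg_left (by linarith) hD₀
  nlinarith

/-- A forced equation `x' + c(t) x(k(t)) = f(t)` with delay at most `1/e` on the clock and
`|f| ≤ F c`: up to a transient that decays like `e^{-σ}`, solutions are bounded by `F` itself.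
The comparison function is `F + K e^{-σ}`. -/
theorem IsClock.le_of_short_delay {σ c x : ℝ → ℝ} {α w p S F X₀ D₀ : ℝ}
    (hσ : IsClock σ c α) (hwp : w ≤ p) (hpS : p ≤ S) (hF : 0 ≤ F) (hD₀ : 0 ≤ D₀)
    (hx : AbsolutelyContinuousOnInterval x p S)
    (hd : ∀ᵐ t, t ∈ Icc p S → ∃ x' k : ℝ, HasDerivAt x x' t ∧ w ≤ k ∧ k ≤ t ∧
      σ t - σ k ≤ 1 / Real.exp 1 ∧ |x' + c t * x k| ≤ F * c t)
    (hX : ∀ θ ∈ Icc w p, |x θ| ≤ X₀) (hD : ClockLipschitzOn σ x D₀ (Icc w p)) :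
    x S ≤ F + (2 * X₀ + D₀) * Real.exp (-(σ S - σ p)) := by
  have hpX := hX p ⟨hwp, le_rfl⟩
  have hX₀ : 0 ≤ X₀ := (abs_nonneg _).trans hpX
  set K : ℝ := 2 * X₀ + D₀ with hK
  have hK0 : 0 ≤ K := by positivity
  have hexp : ∀ t, Real.exp (-(σ t - σ p)) = Real.exp (σ p) * Real.exp (-(1 * σ t)) := fun t => by
    rw [← Real.exp_add]; ring_nf
  have hac : AbsolutelyContinuousOnInterval
      (fun t => K * Real.exp (-(σ t - σ p)) - (x t - F)) p S := by
    have h1 : AbsolutelyContinuousOnInterval (fun _ : ℝ => F) p S :=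
      (LipschitzWith.const F).lipschitzOnWith.absolutelyContinuousOnInterval
    have h2 := (((hσ.absolutelyContinuous_exp_neg_mul zero_le_one hpS).const_mul
      (Real.exp (σ p))).const_mul K).fun_sub (hx.fun_sub h1)
    simpa only [hexp] using h2
  have := hσ.nonneg_of_delay_supersolution (w := w) hpS hac ?_ ?_ ?_
  · linarith
  · filter_upwards [hd, hσ.deriv] with t ht hs htm
    obtain ⟨x', k, h1, h2, h3, h4, h5⟩ := ht htm
    refine ⟨_, k, (((hs.sub_const (σ p)).fun_neg.exp).const_mul K).fun_sub (h1.sub_const F),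
      h2, h3, h4, ?_⟩
    have e1 : Real.exp (-(σ t - σ p)) ≤ Real.exp (-(σ k - σ p)) :=
      Real.exp_le_exp.2 (by linarith [hσ.mono h3])
    have e2 := mul_nonneg (hσ.nonneg t) (mul_nonneg hK0 (sub_nonneg.2 e1))
    have e3 := (abs_le.1 h5).2
    linarith
  · intro θ hθ
    have hdl : 0 ≤ σ p - σ θ := sub_nonneg.2 (hσ.mono hθ.2)
    have e1 := exp_history_inequality hF hD₀ hdl hpX (hD hθ ⟨hwp, le_rfl⟩ hθ.2)
    have e2 : Real.exp (Real.exp 1 * σ p)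
        = Real.exp (Real.exp 1 * (σ p - σ θ)) * Real.exp (Real.exp 1 * σ θ) := by
      rw [← Real.exp_add]; ring_nf
    have e3 := mul_le_mul_of_nonneg_right e1 (Real.exp_pos (Real.exp 1 * σ θ)).le
    rw [show σ p - σ θ = -(σ θ - σ p) by ring] at e3
    rw [e2, show σ p - σ θ = -(σ θ - σ p) by ring]
    simp only [sub_self, neg_zero, Real.exp_zero, mul_one]
    linarith
  · have := (abs_le.1 hpX).2
    simp only [sub_self, neg_zero, Real.exp_zero, mul_one]
    linarith

theorem IsClock.abs_le_of_short_delay {σ c x : ℝ → ℝ} {α w p S F X₀ D₀ : ℝ}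
    (hσ : IsClock σ c α) (hwp : w ≤ p) (hpS : p ≤ S) (hF : 0 ≤ F) (hD₀ : 0 ≤ D₀)
    (hx : AbsolutelyContinuousOnInterval x p S)
    (hd : ∀ᵐ t, t ∈ Icc p S → ∃ x' k : ℝ, HasDerivAt x x' t ∧ w ≤ k ∧ k ≤ t ∧
      σ t - σ k ≤ 1 / Real.exp 1 ∧ |x' + c t * x k| ≤ F * c t)
    (hX : ∀ θ ∈ Icc w p, |x θ| ≤ X₀) (hD : ClockLipschitzOn σ x D₀ (Icc w p)) :
    |x S| ≤ F + (2 * X₀ + D₀) * Real.exp (-(σ S - σ p)) := by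
  refine abs_le'.2 ⟨hσ.le_of_short_delay hwp hpS hF hD₀ hx hd hX hD,
    hσ.le_of_short_delay (x := fun t => -x t) hwp hpS hF hD₀ hx.fun_neg ?_ ?_ ?_⟩
  · filter_upwards [hd] with t ht htm
    obtain ⟨x', k, h1, h2, h3, h4, h5⟩ := ht htm
    refine ⟨_, k, h1.fun_neg, h2, h3, h4, ?_⟩
    rwa [show -x' + c t * -x k = -(x' + c t * x k) by ring, abs_neg]
  · simpa only [abs_neg] using hX
  · intro u hu v hv huv
    have := hD hu hv huv
    rwa [← neg_sub', abs_neg]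

/-! ### The equation on the clock: boundedness and exponential decay -/

/-- The equation `x' = -c(t) x(h(t)) - b(t) (x(h(t)) - x(g(t)))` for almost every `t ≥ s`, together
with the estimates on its delays: on the clock `σ` the delay of `h` exceeds `1/e` by at most `A`,
and `b |σ(h) - σ(g)| ≤ B c`. The last clause bounds the perturbation in terms of `c` alone, where
`b / c` may be unbounded as long as the perturbation vanishes. -/
def ClockEquation (σ c b h g x : ℝ → ℝ) (r A B β s : ℝ) : Prop :=
  ∀ᵐ t, s ≤ t →
    HasDerivAt x (-(c t * x (h t)) - b t * (x (h t) - x (g t))) t ∧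
    (t - r ≤ h t ∧ h t ≤ t) ∧ (t - r ≤ g t ∧ g t ≤ t) ∧ 0 ≤ b t ∧
    σ t - σ (h t) - 1 / Real.exp 1 ≤ A ∧ b t * |σ (h t) - σ (g t)| ≤ B * c t ∧
    (b t ≤ β * c t ∨ h t = g t)

namespace ClockEquation

variable {σ c b h g x : ℝ → ℝ} {α r A B β s : ℝ}

theorem ae_abs_deriv_le_of_lipschitz (hE : ClockEquation σ c b h g x r A B β s)
    (hσ : IsClock σ c α) {D Y p q S : ℝ} (hpq : p + r ≤ q) (hs : s ≤ q) (hD0 : 0 ≤ D)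
    (hD : ClockLipschitzOn σ x D (Icc p S)) (hY : ∀ t ∈ Icc p S, |x t| ≤ Y) :
    ∀ᵐ t, t ∈ Icc q S → ∃ x' : ℝ, HasDerivAt x x' t ∧ |x'| ≤ (Y + B * D) * c t := by
  filter_upwards [hE] with t ht htm
  obtain ⟨h1, h2, h3, h4, -, h6, -⟩ := ht (hs.trans htm.1)
  have hhm : h t ∈ Icc p S := ⟨by linarith [htm.1], h2.2.trans htm.2⟩
  have hgm : g t ∈ Icc p S := ⟨by linarith [htm.1], h3.2.trans htm.2⟩
  refine ⟨_, h1, ?_⟩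
  have e1 : |c t * x (h t)| ≤ c t * Y := by
    rw [abs_mul, abs_of_nonneg (hσ.nonneg t)]
    exact mul_le_mul_of_nonneg_left (hY _ hhm) (hσ.nonneg t)
  have e2 : |b t * (x (h t) - x (g t))| ≤ D * (B * c t) := by
    rw [abs_mul, abs_of_nonneg h4]
    calc b t * |x (h t) - x (g t)| ≤ b t * (D * |σ (h t) - σ (g t)|) :=
          mul_le_mul_of_nonneg_left (hD.abs_sub_le hσ.mono hhm hgm) h4
      _ = D * (b t * |σ (h t) - σ (g t)|) := by ring
      _ ≤ _ := mul_le_mul_of_nonneg_left h6 hD0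
  rw [abs_le] at e1 e2 ⊢
  constructor <;> linarith [e1.1, e1.2, e2.1, e2.2]

theorem ae_abs_deriv_le (hE : ClockEquation σ c b h g x r A B β s)
    (hσ : IsClock σ c α) (hβ : 0 ≤ β) {Y p q S : ℝ} (hpq : p + r ≤ q) (hs : s ≤ q)
    (hY : ∀ t ∈ Icc p S, |x t| ≤ Y) :
    ∀ᵐ t, t ∈ Icc q S → ∃ x' : ℝ, HasDerivAt x x' t ∧ |x'| ≤ ((1 + 2 * β) * Y) * c t := by
  filter_upwards [hE] with t ht htm
  obtain ⟨h1, h2, h3, h4, -, -, h7⟩ := ht (hs.trans htm.1)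
  have e1 := hY (h t) ⟨by linarith [htm.1], h2.2.trans htm.2⟩
  have e2 := hY (g t) ⟨by linarith [htm.1], h3.2.trans htm.2⟩
  have hY0 : 0 ≤ Y := (abs_nonneg _).trans e1
  refine ⟨_, h1, ?_⟩
  have hc := hσ.nonneg t
  have e3 : |c t * x (h t)| ≤ c t * Y := by
    rw [abs_mul, abs_of_nonneg hc]
    exact mul_le_mul_of_nonneg_left e1 hc
  have e4 : |b t * (x (h t) - x (g t))| ≤ β * c t * (2 * Y) := by
    rcases h7 with h7 | h7
    · rw [abs_mul, abs_of_nonneg h4]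
      have : |x (h t) - x (g t)| ≤ 2 * Y := (abs_sub _ _).trans (by linarith)
      exact mul_le_mul h7 this (abs_nonneg _) (mul_nonneg hβ hc)
    · rw [h7, sub_self, mul_zero, abs_zero]
      positivity
  rw [abs_le] at e3 e4 ⊢
  constructor <;> linarith [e3.1, e3.2, e4.1, e4.2]

/-- Replacing `h(t)` by a point `k` whose delay on the clock is at most `1/e` leaves a residual
bounded by `(A + B) D c`, where `D` is a Lipschitz constant of the solution on the clock. -/
theorem ae_short_delay (hE : ClockEquation σ c b h g x r A B β s)
    (hσ : IsClock σ c α) {D p q S : ℝ} (hpq : p + r ≤ q) (hs : s ≤ q) (hA : 0 ≤ A) (hD0 : 0 ≤ D)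
    (hD : ClockLipschitzOn σ x D (Icc p S)) :
    ∀ᵐ t, t ∈ Icc q S → ∃ x' k : ℝ, HasDerivAt x x' t ∧ p ≤ k ∧ k ≤ t ∧
      σ t - σ k ≤ 1 / Real.exp 1 ∧ |x' + c t * x k| ≤ ((A + B) * D) * c t := by
  filter_upwards [hE] with t ht htm
  obtain ⟨h1, h2, h3, h4, h5, h6, -⟩ := ht (hs.trans htm.1)
  have hhm : h t ∈ Icc p S := ⟨by linarith [htm.1], h2.2.trans htm.2⟩
  have hgm : g t ∈ Icc p S := ⟨by linarith [htm.1], h3.2.trans htm.2⟩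
  have hc := hσ.nonneg t
  have e2 : |b t * (x (h t) - x (g t))| ≤ D * (B * c t) := by
    rw [abs_mul, abs_of_nonneg h4]
    calc b t * |x (h t) - x (g t)| ≤ b t * (D * |σ (h t) - σ (g t)|) :=
          mul_le_mul_of_nonneg_left (hD.abs_sub_le hσ.mono hhm hgm) h4
      _ = D * (b t * |σ (h t) - σ (g t)|) := by ring
      _ ≤ _ := mul_le_mul_of_nonneg_left h6 hD0
  obtain ⟨k, hk1, hk2, hk3, hk4⟩ : ∃ k, h t ≤ k ∧ k ≤ t ∧ σ t - σ k ≤ 1 / Real.exp 1 ∧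
      σ k - σ (h t) ≤ A := by
    rcases le_total (σ t - σ (h t)) (1 / Real.exp 1) with hle | hle
    · exact ⟨h t, le_rfl, h2.2, hle, by linarith⟩
    · have hpos : 0 < 1 / Real.exp 1 := by positivity
      obtain ⟨k, hk, hkσ⟩ := intermediate_value_Icc h2.2 hσ.continuous.continuousOn
        (show σ t - 1 / Real.exp 1 ∈ Icc (σ (h t)) (σ t) from ⟨by linarith, by linarith⟩)
      exact ⟨k, hk.1, hk.2, by linarith, by linarith⟩
  have hkm : k ∈ Icc p S := ⟨hhm.1.trans hk1, hk2.trans htm.2⟩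
  refine ⟨_, k, h1, hkm.1, hk2, hk3, ?_⟩
  have e3 : |c t * (x k - x (h t))| ≤ c t * (D * A) := by
    rw [abs_mul, abs_of_nonneg hc]
    exact mul_le_mul_of_nonneg_left
      ((hD hhm hkm hk1).trans (mul_le_mul_of_nonneg_left hk4 hD0)) hc
  rw [abs_le] at e2 e3 ⊢
  constructor <;> linarith [e2.1, e2.2, e3.1, e3.2]

/-- One pass of the a priori estimate. A Lipschitz constant `D` bounds the solution by
`(A + B) D` up to initial data, hence its derivative on the clock by `(A + 2B) D`. -/
theorem lipschitz_improve (hE : ClockEquation σ c b h g x r A B β s)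
    (hσ : IsClock σ c α) (hr : 0 ≤ r) (hA : 0 ≤ A) (hB : 0 ≤ B) {p S X₀ D₀ D : ℝ}
    (hs : s ≤ p + r) (hD0 : 0 ≤ D) (hD₀ : 0 ≤ D₀) (hx : AbsolutelyContinuousOnInterval x p S)
    (hpS : p + r ≤ S)
    (hX : ∀ t ∈ Icc p (p + r), |x t| ≤ X₀) (hL₀ : ClockLipschitzOn σ x D₀ (Icc p (p + r)))
    (hD : ClockLipschitzOn σ x D (Icc p S)) :
    (∀ t ∈ Icc p S, |x t| ≤ (A + B) * D + (2 * X₀ + D₀)) ∧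
      ClockLipschitzOn σ x ((A + 2 * B) * D + (2 * X₀ + 2 * D₀)) (Icc p S) := by
  have hX₀ : 0 ≤ X₀ := (abs_nonneg _).trans (hX p ⟨le_rfl, by linarith⟩)
  have hABD : 0 ≤ (A + B) * D := by positivity
  have hac : ∀ q t, p ≤ q → t ≤ S → q ≤ t → AbsolutelyContinuousOnInterval x q t := by
    intro q t hq ht hqt
    refine hx.mono ?_
    rw [uIcc_of_le hqt, uIcc_of_le (by linarith)]
    exact Icc_subset_Icc hq ht
  have hY : ∀ t ∈ Icc p S, |x t| ≤ (A + B) * D + (2 * X₀ + D₀) := by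
    intro t ht
    rcases le_total t (p + r) with h | h
    · linarith [hX t ⟨ht.1, h⟩]
    · have e1 := hσ.abs_le_of_short_delay (w := p) (by linarith) h hABD hD₀
        (hac _ _ (by linarith) ht.2 h)
        (hE.ae_short_delay hσ le_rfl hs hA hD0 (hD.subset (Icc_subset_Icc_right ht.2))) hX hL₀
      have e2 : Real.exp (-(σ t - σ (p + r))) ≤ 1 :=
        Real.exp_le_one_iff.2 (by linarith [hσ.mono h])
      have e3 : (2 * X₀ + D₀) * Real.exp (-(σ t - σ (p + r))) ≤ (2 * X₀ + D₀) * 1 :=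
        mul_le_mul_of_nonneg_left e2 (by positivity)
      linarith
  refine ⟨hY, ClockLipschitzOn.append (q := p + r) (hL₀.mono_const hσ.mono ?_)
    ((hσ.clockLipschitzOn (hac _ _ (by linarith) le_rfl hpS)
      (hE.ae_abs_deriv_le_of_lipschitz hσ le_rfl hs hD0 hD hY)).mono_const hσ.mono ?_)⟩
  · nlinarith [mul_nonneg hB hD0]
  · nlinarith

theorem _root_.ClockLipschitzOn.of_improvement {D ρ C : ℝ} {t : Set ℝ}
    (hρ0 : 0 ≤ ρ) (hρ : ρ < 1) (hC : 0 ≤ C) (hD0 : 0 ≤ D) (hD : ClockLipschitzOn σ x D t)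
    (himp : ∀ D', 0 ≤ D' → ClockLipschitzOn σ x D' t → ClockLipschitzOn σ x (ρ * D' + C) t) :
    ClockLipschitzOn σ x (C / (1 - ρ)) t := by
  have hρ1 : 1 - ρ ≠ 0 := by linarith
  have hiter : ∀ n : ℕ, 0 ≤ ρ ^ n * D + C / (1 - ρ) * (1 - ρ ^ n) ∧
      ClockLipschitzOn σ x (ρ ^ n * D + C / (1 - ρ) * (1 - ρ ^ n)) t := by
    intro n
    induction n with
    | zero => simpa using ⟨hD0, hD⟩
    | succ n ih =>
      have e : ρ ^ (n + 1) * D + C / (1 - ρ) * (1 - ρ ^ (n + 1))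
          = ρ * (ρ ^ n * D + C / (1 - ρ) * (1 - ρ ^ n)) + C := by
        field_simp
        ring
      rw [e]
      exact ⟨add_nonneg (mul_nonneg hρ0 ih.1) hC, himp _ ih.1 ih.2⟩
  intro u hu v hv huv
  have h0 := tendsto_pow_atTop_nhds_zero_of_lt_one hρ0 hρ
  have h1 : Tendsto (fun n : ℕ => (ρ ^ n * D + C / (1 - ρ) * (1 - ρ ^ n)) * (σ v - σ u)) atTop
      (𝓝 ((0 * D + C / (1 - ρ) * (1 - 0)) * (σ v - σ u))) :=
    ((h0.mul_const D).add ((tendsto_const_nhds.sub h0).const_mul _)).mul_const _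
  have h2 := ge_of_tendsto' h1 fun n => (hiter n).2 hu hv huv
  simpa using h2

/-- Uniform boundedness, and a uniform Lipschitz constant on the clock, in terms of the data on an
interval of length `r`. -/
theorem bounded (hE : ClockEquation σ c b h g x r A B β s)
    (hσ : IsClock σ c α) (hr : 0 ≤ r) (hA : 0 ≤ A) (hB : 0 ≤ B) (hβ : 0 ≤ β)
    (hAB : A + 2 * B < 1) {p X₀ D₀ : ℝ}
    (hs : s ≤ p + r) (hD₀ : 0 ≤ D₀) (hx : ∀ S, p ≤ S → AbsolutelyContinuousOnInterval x p S)
    (hX : ∀ t ∈ Icc p (p + r), |x t| ≤ X₀) (hL₀ : ClockLipschitzOn σ x D₀ (Icc p (p + r))) :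
    (∀ t ∈ Ici p, |x t| ≤ (2 * X₀ + 2 * D₀) / (1 - (A + 2 * B))) ∧
      ClockLipschitzOn σ x ((2 * X₀ + 2 * D₀) / (1 - (A + 2 * B))) (Ici p) := by
  have hX₀ : 0 ≤ X₀ := (abs_nonneg _).trans (hX p ⟨le_rfl, by linarith⟩)
  set L := (2 * X₀ + 2 * D₀) / (1 - (A + 2 * B)) with hL
  have hL0 : 0 ≤ L := div_nonneg (by positivity) (by linarith)
  have hLeq : (A + 2 * B) * L + (2 * X₀ + 2 * D₀) = L := by
    rw [hL]
    field_simp [show 1 - (A + 2 * B) ≠ 0 by linarith]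
    ring
  have key : ∀ S, p + r ≤ S →
      (∀ t ∈ Icc p S, |x t| ≤ L) ∧ ClockLipschitzOn σ x L (Icc p S) := by
    intro S hS
    obtain ⟨Y, hY⟩ := (hx S (by linarith)).exists_bound
    rw [uIcc_of_le (by linarith)] at hY
    have hY0 : 0 ≤ Y := (norm_nonneg _).trans (hY p ⟨le_rfl, by linarith⟩)
    have hsub : uIcc (p + r) S ⊆ uIcc p S := by
      rw [uIcc_of_le hS, uIcc_of_le (by linarith)]
      exact Icc_subset_Icc_left (by linarith)
    have hD1 : ClockLipschitzOn σ x (D₀ + (1 + 2 * β) * Y) (Icc p S) :=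
      ClockLipschitzOn.append (q := p + r)
        (hL₀.mono_const hσ.mono (by nlinarith [mul_nonneg hβ hY0]))
        ((hσ.clockLipschitzOn ((hx S (by linarith)).mono hsub)
          (hE.ae_abs_deriv_le hσ hβ le_rfl hs hY)).mono_const hσ.mono (by linarith))
    have himp := fun D hD0 hD => hE.lipschitz_improve hσ hr hA hB (D := D) hs hD0 hD₀
      (hx S (by linarith)) hS hX hL₀ hD
    have hlip : ClockLipschitzOn σ x L (Icc p S) :=
      ClockLipschitzOn.of_improvement (by positivity) hAB (by positivity) (by positivity) hD1
        fun D hD0 hD => (himp D hD0 hD).2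
    exact ⟨fun t ht => ((himp L hL0 hlip).1 t ht).trans (by nlinarith), hlip⟩
  refine ⟨fun t ht => (key (max t (p + r)) (le_max_right _ _)).1 t ⟨ht, le_max_left _ _⟩, ?_⟩
  intro u hu v hv huv
  exact (key (max v (p + r)) (le_max_right _ _)).2 ⟨hu, huv.trans (le_max_left _ _)⟩
    ⟨hv, le_max_left _ _⟩ huv

/-- Contraction: within a fixed amount of clock time the bound and the Lipschitz constant of a
solution both shrink by the factor `ρ > A + 2B`. Here `Λ` is the time after which the transient is
negligible, and each of the two waiting periods of length `r` costs at most `α r` on the clock. -/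
theorem contraction (hE : ClockEquation σ c b h g x r A B β s)
    (hσ : IsClock σ c α) (hσt : Tendsto σ atTop atTop) (hr : 0 ≤ r) (hA : 0 ≤ A) (hB : 0 ≤ B)
    {p N ρ Λ : ℝ} (hΛ0 : 0 ≤ Λ) (hΛ : 3 * Real.exp (-Λ) ≤ ρ - (A + 2 * B))
    (hs : s ≤ p + r) (hx : ∀ S, p ≤ S → AbsolutelyContinuousOnInterval x p S)
    (hX : ∀ t ∈ Ici p, |x t| ≤ N) (hL : ClockLipschitzOn σ x N (Ici p)) :
    ∃ p', p ≤ p' ∧ σ p' ≤ σ p + (2 * (α * r) + Λ) ∧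
      (∀ t ∈ Ici p', |x t| ≤ ρ * N) ∧ ClockLipschitzOn σ x (ρ * N) (Ici p') := by
  have hN : 0 ≤ N := (abs_nonneg _).trans (hX p self_mem_Ici)
  have hac : ∀ q S, p ≤ q → q ≤ S → AbsolutelyContinuousOnInterval x q S := by
    intro q S hq hS
    refine (hx S (hq.trans hS)).mono ?_
    rw [uIcc_of_le hS, uIcc_of_le (hq.trans hS)]
    exact Icc_subset_Icc_left hq
  obtain ⟨T, hT, hTq⟩ := ((hσt.eventually_ge_atTop (σ (p + r) + Λ)).and
    (eventually_ge_atTop (p + r))).exists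
  obtain ⟨q, hq, hqσ⟩ := intermediate_value_Icc hTq hσ.continuous.continuousOn
    (show σ (p + r) + Λ ∈ Icc (σ (p + r)) (σ T) from ⟨by linarith, hT⟩)
  have hpq : p ≤ q := by linarith [hq.1]
  -- the margin `B N` is left for the perturbation in the subsequent estimate of the derivative
  have hsmall : ∀ t ∈ Ici q, |x t| ≤ (ρ - B) * N := by
    intro t ht
    have hqt : q ≤ t := ht
    have e1 := hσ.abs_le_of_short_delay (w := p) (p := p + r) (F := (A + B) * N)
      (by linarith) (hq.1.trans ht) (by positivity) hN (hac _ _ (by linarith) (hq.1.trans ht))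
      (hE.ae_short_delay hσ le_rfl hs hA hN (hL.subset Icc_subset_Ici_self))
      (fun θ hθ => hX θ hθ.1) (hL.subset Icc_subset_Ici_self)
    have e2 : Real.exp (-(σ t - σ (p + r))) ≤ Real.exp (-Λ) :=
      Real.exp_le_exp.2 (by linarith [hσ.mono hqt])
    nlinarith
  have hρB : (ρ - B) * N ≤ ρ * N := by nlinarith
  refine ⟨q + r, by linarith, ?_, fun t ht => (hsmall t ?_).trans hρB, ?_⟩
  · have h1 := hσ.lip p (p + r) (by linarith)
    have h2 := hσ.lip q (q + r) (by linarith)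
    simp only [add_sub_cancel_left] at h1 h2
    linarith
  · exact le_trans (by linarith) (mem_Ici.1 ht)
  · intro u hu v hv huv
    have hu' : q + r ≤ u := hu
    have := hσ.clockLipschitzOn (hac u v (by linarith) huv)
      ((hE.ae_abs_deriv_le_of_lipschitz hσ (p := q) (q := u) (S := v) (Y := (ρ - B) * N) (D := N)
        hu' (by linarith) hN (hL.subset fun t ht => hpq.trans ht.1)
        fun t ht => hsmall t ht.1))
    exact (this ⟨le_rfl, huv⟩ ⟨huv, le_rfl⟩ huv).trans (le_of_eq (by ring))

theorem geometric_decay (hE : ClockEquation σ c b h g x r A B β s)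
    (hσ : IsClock σ c α) (hσt : Tendsto σ atTop atTop) (hr : 0 ≤ r) (hA : 0 ≤ A) (hB : 0 ≤ B)
    {ρ Λ Γ : ℝ} (hΛ0 : 0 ≤ Λ) (hΛ : 3 * Real.exp (-Λ) ≤ ρ - (A + 2 * B))
    (hΓ : 2 * (α * r) + Λ < Γ) (n : ℕ) :
    ∀ {p N : ℝ}, s ≤ p + r → (∀ S, p ≤ S → AbsolutelyContinuousOnInterval x p S) →
      (∀ t ∈ Ici p, |x t| ≤ N) → ClockLipschitzOn σ x N (Ici p) →
      ∀ t, p ≤ t → σ p + n * Γ ≤ σ t → |x t| ≤ ρ ^ n * N := by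
  induction n with
  | zero =>
    intro p N _ _ hX _ t ht _
    simpa using hX t ht
  | succ n ih =>
    intro p N hs hx hX hL t ht hσt'
    obtain ⟨p', hpp', hσp', hX', hL'⟩ := hE.contraction hσ hσt hr hA hB hΛ0 hΛ hs hx hX hL
    push_cast at hσt'
    have hΓ0 : 0 ≤ Γ := by have := mul_nonneg hσ.bound_nonneg hr; linarith
    -- strictness of `hΓ` places `t` after `p'` although the clock is only known to be monotone
    have hp't : p' ≤ t := by
      by_contra hcon
      have := hσ.mono (le_of_not_ge hcon)
      have := mul_nonneg n.cast_nonneg hΓ0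
      linarith
    have hx' : ∀ S, p' ≤ S → AbsolutelyContinuousOnInterval x p' S := by
      intro S hS
      refine (hx S (hpp'.trans hS)).mono ?_
      rw [uIcc_of_le hS, uIcc_of_le (hpp'.trans hS)]
      exact Icc_subset_Icc_left hpp'
    have := ih (by linarith) hx' hX' hL' t hp't (by linarith)
    rwa [pow_succ, mul_assoc]

end ClockEquation

/-- The rate `γ` and the constant `M` depend only on the data of the equation. -/
theorem ClockEquation.exists_exponential_decay {σ c : ℝ → ℝ} {α r A B : ℝ}
    (hσ : IsClock σ c α) (hσt : Tendsto σ atTop atTop) (hr : 0 ≤ r) (hA : 0 ≤ A) (hB : 0 ≤ B)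
    (hAB : A + 2 * B < 1) :
    ∃ M γ : ℝ, 1 ≤ M ∧ 0 < γ ∧ ∀ {b h g x : ℝ → ℝ} {β s p N : ℝ},
      ClockEquation σ c b h g x r A B β s → s ≤ p + r →
      (∀ S, p ≤ S → AbsolutelyContinuousOnInterval x p S) →
      (∀ t ∈ Ici p, |x t| ≤ N) → ClockLipschitzOn σ x N (Ici p) →
      ∀ t, p ≤ t → |x t| ≤ M * Real.exp (-γ * (σ t - σ p)) * N := by
  set ρ : ℝ := (1 + (A + 2 * B)) / 2 with hρdef
  have hρ0 : 0 < ρ := by positivity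
  have hρ1 : ρ < 1 := by rw [hρdef]; linarith
  obtain ⟨Λ, hΛ, hΛ0⟩ : ∃ Λ : ℝ, 3 * Real.exp (-Λ) ≤ ρ - (A + 2 * B) ∧ 0 ≤ Λ := by
    have h1 : Tendsto (fun Λ : ℝ => 3 * Real.exp (-Λ)) atTop (𝓝 (3 * 0)) :=
      Real.tendsto_exp_neg_atTop_nhds_zero.const_mul 3
    have h2 : 3 * (0 : ℝ) < ρ - (A + 2 * B) := by rw [hρdef]; linarith
    exact ((h1.eventually_le_const h2).and (eventually_ge_atTop 0)).exists
  set Γ : ℝ := 2 * (α * r) + Λ + 1 with hΓdef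
  have hαr := mul_nonneg hσ.bound_nonneg hr
  have hΓ0 : 0 < Γ := by positivity
  have hlog : Real.log ρ < 0 := Real.log_neg hρ0 hρ1
  refine ⟨ρ⁻¹, -Real.log ρ / Γ, (one_le_inv₀ hρ0).2 hρ1.le, div_pos (by linarith) hΓ0, ?_⟩
  intro b h g x β s p N hE hs hx hX hL t ht
  have hN : 0 ≤ N := (abs_nonneg _).trans (hX p self_mem_Ici)
  have hd : 0 ≤ σ t - σ p := sub_nonneg.2 (hσ.mono ht)
  -- the factor `ρ⁻¹` makes up for the incomplete last period
  set n := ⌊(σ t - σ p) / Γ⌋₊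
  have hn1 : n * Γ ≤ σ t - σ p :=
    (le_div_iff₀ hΓ0).1 (Nat.floor_le (div_nonneg hd hΓ0.le))
  have hn2 : (σ t - σ p) / Γ ≤ n + 1 := (Nat.lt_floor_add_one _).le
  have h1 := hE.geometric_decay hσ hσt hr hA hB hΛ0 hΛ (Γ := Γ) (by linarith) n hs hx hX hL t ht
    (by linarith)
  refine h1.trans (mul_le_mul_of_nonneg_right ?_ hN)
  have e1 : ρ ^ n = ρ⁻¹ * Real.exp (Real.log ρ * (n + 1)) := by
    have : Real.exp (Real.log ρ * (n + 1)) = ρ ^ (n + 1) := by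
      rw [← Real.rpow_natCast, Real.rpow_def_of_pos hρ0]
      push_cast
      rfl
    rw [this, pow_succ]
    field_simp
  rw [e1]
  refine mul_le_mul_of_nonneg_left (Real.exp_le_exp.2 ?_) (inv_pos.2 hρ0).le
  rw [show - (-Real.log ρ / Γ) * (σ t - σ p) = Real.log ρ * ((σ t - σ p) / Γ) by ring]
  exact mul_le_mul_of_nonpos_left hn2 hlog.le

/-! ### The delay equation -/

theorem IsInitialFunction.abs_le_initialSup {r t₀ : ℝ} {φ : ℝ → ℝ}
    (hφ : IsInitialFunction r t₀ φ) {t : ℝ} (ht : t ∈ Icc (t₀ - r) t₀) :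
    |φ t| ≤ initialSup r t₀ φ := by
  obtain ⟨C, hC⟩ := hφ.bounded
  refine le_csSup ⟨C, ?_⟩ (mem_image_of_mem _ ht)
  rintro _ ⟨s, hs, rfl⟩
  exact hC s hs

/-- A priori growth estimate. With `m` the maximum of `|x(t)| e^{-α(t - t₀)}` over `[t₀, S]`,
`|x'| ≤ α m e^{α(t - t₀)}`, so that integration up to a maximum point gives `m ≤ |x(t₀)|` as soon
as `m` exceeds the bound of the initial function. -/
theorem IsDelaySolution.abs_le_exp {a b h g φ x : ℝ → ℝ} {r t₀ α : ℝ} (ht₀ : 0 ≤ t₀) (hr : 0 ≤ r)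
    (hab : ∀ t, 0 ≤ t → 0 ≤ b t ∧ b t ≤ a t)
    (hα : ∀ᵐ t, 0 ≤ t → a t + b t ≤ α) (hα0 : 0 ≤ α)
    (hh : ∀ t, 0 ≤ t → t - r ≤ h t ∧ h t ≤ t) (hg : ∀ t, 0 ≤ t → t - r ≤ g t ∧ g t ≤ t)
    (hφ : IsInitialFunction r t₀ φ) (hx : IsDelaySolution a b h g r t₀ φ x) {t : ℝ}
    (ht : t₀ ≤ t) : |x t| ≤ initialSup r t₀ φ * Real.exp (α * (t - t₀)) := by
  set X := initialSup r t₀ φ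
  have hini : ∀ θ ∈ Icc (t₀ - r) t₀, |x θ| ≤ X := fun θ hθ => by
    rw [hx.initial θ hθ]
    exact hφ.abs_le_initialSup hθ
  have hX0 : |x t₀| ≤ X := hini t₀ ⟨by linarith, le_rfl⟩
  have hXnn : 0 ≤ X := (abs_nonneg _).trans hX0
  have hcont : ContinuousOn (fun u => |x u| * Real.exp (-(α * (u - t₀)))) (Icc t₀ t) := by
    have h1 := (hx.absCont t ht).continuousOn
    rw [uIcc_of_le ht] at h1
    exact h1.abs.mul (by fun_prop)
  obtain ⟨z, hz, hzmax⟩ := isCompact_Icc.exists_isMaxOn ⟨t₀, left_mem_Icc.2 ht⟩ hcont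
  set m : ℝ := |x z| * Real.exp (-(α * (z - t₀))) with hm
  have hle : ∀ u ∈ Icc t₀ t, |x u| ≤ m * Real.exp (α * (u - t₀)) := by
    intro u hu
    have h1 : |x u| * Real.exp (-(α * (u - t₀))) ≤ m := hzmax hu
    rwa [Real.exp_neg, ← div_eq_mul_inv, div_le_iff₀ (Real.exp_pos _)] at h1
  have hxz : m * Real.exp (α * (z - t₀)) = |x z| := by
    rw [hm, mul_assoc, ← Real.exp_add, neg_add_cancel, Real.exp_zero, mul_one]
  have hm0 : 0 ≤ m := by positivity
  suffices hmX : m ≤ X from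
    (hle t ⟨ht, le_rfl⟩).trans (mul_le_mul_of_nonneg_right hmX (Real.exp_pos _).le)
  by_contra! hXm
  have hpast : ∀ u v, t₀ - r ≤ u → u ≤ v → t₀ ≤ v → v ≤ t →
      |x u| ≤ m * Real.exp (α * (v - t₀)) := by
    intro u v h1 h2 h3 h4
    rcases le_total t₀ u with h5 | h5
    · refine (hle u ⟨h5, h2.trans h4⟩).trans (mul_le_mul_of_nonneg_left ?_ hm0)
      exact Real.exp_le_exp.2 (by nlinarith)
    · have : 1 ≤ Real.exp (α * (v - t₀)) :=
        Real.one_le_exp (mul_nonneg hα0 (by linarith))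
      nlinarith [hini u ⟨h1, h5⟩]
  have hxac : AbsolutelyContinuousOnInterval x t₀ z := hx.absCont z hz.1
  have hGac : AbsolutelyContinuousOnInterval (fun u => m * Real.exp (α * (u - t₀))) t₀ z :=
    ContDiffOn.absolutelyContinuousOnInterval
      (ContDiff.contDiffOn (by fun_prop))
  have heq := hx.equation
  rw [ae_restrict_iff' measurableSet_Ici] at heq
  have hfin := hxac.abs_sub_le_of_ae_deriv_le hz.1 hGac (by
    filter_upwards [heq, hα] with u hu huα hum
    obtain ⟨x', h1, h2⟩ := hu hum.1
    have hu0 : 0 ≤ u := ht₀.trans hum.1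
    obtain ⟨hb0, hba⟩ := hab u hu0
    have hut : u ≤ t := hum.2.trans hz.2
    refine ⟨x', _, h1, ((((hasDerivAt_id u).sub_const t₀).const_mul α).exp).const_mul m, ?_⟩
    have e1 := hpast (h u) u (by linarith [(hh u hu0).1, hum.1]) (hh u hu0).2 hum.1 hut
    have e2 := hpast (g u) u (by linarith [(hg u hu0).1, hum.1]) (hg u hu0).2 hum.1 hut
    have hmE : 0 ≤ m * Real.exp (α * (u - t₀)) := by positivity
    have e3 : |a u * x (h u)| ≤ a u * (m * Real.exp (α * (u - t₀))) := by
      rw [abs_mul, abs_of_nonneg (hb0.trans hba)]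
      exact mul_le_mul_of_nonneg_left e1 (hb0.trans hba)
    have e4 : |b u * x (g u)| ≤ b u * (m * Real.exp (α * (u - t₀))) := by
      rw [abs_mul, abs_of_nonneg hb0]
      exact mul_le_mul_of_nonneg_left e2 hb0
    have e5 := mul_le_mul_of_nonneg_right (huα hu0) hmE
    simp only [id]
    rw [abs_le] at e3 e4 ⊢
    constructor <;> linarith [e3.1, e3.2, e4.1, e4.2])
  rw [hxz, sub_self, mul_zero, Real.exp_zero, mul_one] at hfin
  have := abs_sub_abs_le_abs_sub (x z) (x t₀)
  linarith

/-- The clock `t ↦ ∫_0^t (a - b)` of the delay equation, constant for `t ≤ 0`. -/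
noncomputable def delayClock (a b : ℝ → ℝ) (t : ℝ) : ℝ :=
  ∫ s in (0 : ℝ)..t, (Ici (0 : ℝ)).indicator (fun s => a s - b s) s

section Clock

variable {a b : ℝ → ℝ}

theorem delayClock_of_nonneg {t : ℝ} (ht : 0 ≤ t) :
    delayClock a b t = ∫ s in (0 : ℝ)..t, (a s - b s) := by
  refine intervalIntegral.integral_congr fun s hs => ?_
  rw [uIcc_of_le ht] at hs
  exact indicator_of_mem (show s ∈ Ici (0 : ℝ) from hs.1) _

theorem indicator_sub_nonneg (hab : ∀ t, 0 ≤ t → 0 ≤ b t ∧ b t ≤ a t) (t : ℝ) :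
    0 ≤ (Ici (0 : ℝ)).indicator (fun s => a s - b s) t :=
  indicator_nonneg (fun t ht => sub_nonneg.2 (hab t ht).2) t

theorem locallyIntegrable_indicator_sub (ha : MemLp a ∞ (volume.restrict (Ici 0)))
    (hb : MemLp b ∞ (volume.restrict (Ici 0))) :
    LocallyIntegrable ((Ici (0 : ℝ)).indicator (fun s => a s - b s)) :=
  ((memLp_indicator_iff_restrict measurableSet_Ici).2 (ha.sub hb)).locallyIntegrable le_top

theorem intervalIntegrable_indicator_sub (ha : MemLp a ∞ (volume.restrict (Ici 0)))
    (hb : MemLp b ∞ (volume.restrict (Ici 0))) (u v : ℝ) :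
    IntervalIntegrable ((Ici (0 : ℝ)).indicator (fun s => a s - b s)) volume u v :=
  intervalIntegrable_iff.2 <| ((locallyIntegrable_indicator_sub ha hb).integrableOn_isCompact
    isCompact_uIcc).mono_set uIoc_subset_uIcc

theorem delayClock_sub (ha : MemLp a ∞ (volume.restrict (Ici 0)))
    (hb : MemLp b ∞ (volume.restrict (Ici 0))) (u v : ℝ) :
    delayClock a b v - delayClock a b u
      = ∫ s in u..v, (Ici (0 : ℝ)).indicator (fun s => a s - b s) s :=
  intervalIntegral.integral_interval_sub_left
    (intervalIntegrable_indicator_sub ha hb _ _) (intervalIntegrable_indicator_sub ha hb _ _)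

theorem integral_sub_eq_delayClock_sub (ha : MemLp a ∞ (volume.restrict (Ici 0)))
    (hb : MemLp b ∞ (volume.restrict (Ici 0))) {u v : ℝ} (hu : 0 ≤ u) (hv : 0 ≤ v) :
    ∫ s in u..v, (a s - b s) = delayClock a b v - delayClock a b u := by
  rw [delayClock_sub ha hb]
  refine intervalIntegral.integral_congr fun s hs => ?_
  have : s ∈ Ici (0 : ℝ) := (le_min hu hv).trans hs.1
  exact (indicator_of_mem this (fun s => a s - b s)).symm

theorem netIntegral_eq (ha : MemLp a ∞ (volume.restrict (Ici 0)))
    (hb : MemLp b ∞ (volume.restrict (Ici 0))) {u v : ℝ} (hu : 0 ≤ u) (hv : 0 ≤ v) :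
    netIntegral a b u v = delayClock a b v - delayClock a b u := by
  rw [netIntegral, max_eq_left hu, max_eq_left hv, integral_sub_eq_delayClock_sub ha hb hu hv]

theorem monotone_delayClock (ha : MemLp a ∞ (volume.restrict (Ici 0)))
    (hb : MemLp b ∞ (volume.restrict (Ici 0))) (hab : ∀ t, 0 ≤ t → 0 ≤ b t ∧ b t ≤ a t) :
    Monotone (delayClock a b) := by
  intro u v huv
  rw [← sub_nonneg, delayClock_sub ha hb]
  exact intervalIntegral.integral_nonneg_of_forall huv (indicator_sub_nonneg hab)

theorem isClock_delayClock (ha : MemLp a ∞ (volume.restrict (Ici 0)))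
    (hb : MemLp b ∞ (volume.restrict (Ici 0))) (hab : ∀ t, 0 ≤ t → 0 ≤ b t ∧ b t ≤ a t)
    {α : ℝ} (hα0 : 0 ≤ α) (hα : ∀ᵐ t, 0 ≤ t → a t + b t ≤ α) :
    IsClock (delayClock a b) ((Ici (0 : ℝ)).indicator (fun s => a s - b s)) α := by
  have hli := locallyIntegrable_indicator_sub ha hb
  refine ⟨indicator_sub_nonneg hab, monotone_delayClock ha hb hab, fun u v huv => ?_, ?_⟩
  · rw [delayClock_sub ha hb]
    have h1 : ∫ _ in u..v, α = α * (v - u) := by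
      rw [intervalIntegral.integral_const, smul_eq_mul, mul_comm]
    rw [← h1]
    refine intervalIntegral.integral_mono_ae huv
      (intervalIntegrable_indicator_sub ha hb _ _) intervalIntegrable_const ?_
    filter_upwards [hα] with t ht
    by_cases h0 : t ∈ Ici (0 : ℝ)
    · rw [indicator_of_mem h0]
      linarith [ht h0, (hab t h0).1]
    · rwa [indicator_of_notMem h0]
  · filter_upwards [LocallyIntegrable.ae_hasDerivAt_integral hli] with t ht
    exact ht 0

/-- As `a - b > 0` almost everywhere, the clock is strictly increasing on `[0, ∞)`. -/
theorem delayClock_lt (ha : MemLp a ∞ (volume.restrict (Ici 0)))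
    (hb : MemLp b ∞ (volume.restrict (Ici 0))) (hab : ∀ t, 0 ≤ t → 0 ≤ b t ∧ b t ≤ a t)
    (hne : ∀ᵐ t ∂(volume.restrict (Ici (0 : ℝ))), a t - b t ≠ 0) {u v : ℝ} (hu : 0 ≤ u)
    (huv : u < v) : delayClock a b u < delayClock a b v := by
  rw [← sub_pos, delayClock_sub ha hb, intervalIntegral.integral_pos_iff_support_of_nonneg_ae
    (ae_of_all _ (indicator_sub_nonneg hab))
    (intervalIntegrable_indicator_sub ha hb _ _)]
  refine ⟨huv, ?_⟩
  rw [ae_restrict_iff' measurableSet_Ici] at hne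
  have hvol : 0 < volume (Ioc u v) := by simpa using huv
  refine hvol.trans_le (measure_mono_ae ?_)
  filter_upwards [hne] with t ht
  intro htm
  have h0 : t ∈ Ici (0 : ℝ) := hu.trans (le_of_lt htm.1)
  refine ⟨?_, htm⟩
  rw [Function.mem_support, indicator_of_mem h0]
  exact ht h0

end Clock

/-! ### The smallness condition -/

theorem ae_abs_le_toReal_essNorm {t₀ : ℝ} {f : ℝ → ℝ} (hf : essNorm t₀ f ≠ ∞) :
    ∀ᵐ t, t₀ ≤ t → |f t| ≤ (essNorm t₀ f).toReal := by
  have h := ae_le_eLpNormEssSup (f := f) (μ := volume.restrict (Ici t₀))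
  rw [ae_restrict_iff' measurableSet_Ici] at h
  filter_upwards [h] with t ht ht0
  have h1 : ‖f t‖ₑ ≤ essNorm t₀ f := by
    rw [essNorm, eLpNorm_exponent_top]
    exact ht ht0
  have h2 := ENNReal.toReal_mono hf h1
  rwa [toReal_enorm, Real.norm_eq_abs] at h2

theorem ae_abs_eq_zero_of_essNorm {t₀ : ℝ} {f : ℝ → ℝ} (hf : essNorm t₀ f = 0) :
    ∀ᵐ t, t₀ ≤ t → f t = 0 := by
  filter_upwards [ae_abs_le_toReal_essNorm (f := f) (t₀ := t₀) (by simp [hf])] with t ht ht0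
  simpa [hf] using ht ht0

/-- A product of essential suprema that is finite in `[0, ∞]` controls the pointwise product. -/
theorem ae_abs_mul_le_essNorm_mul {t₀ : ℝ} {f k : ℝ → ℝ}
    (hfk : essNorm t₀ f * essNorm t₀ k ≠ ∞) :
    ∀ᵐ t, t₀ ≤ t → |f t| * |k t| ≤ (essNorm t₀ f * essNorm t₀ k).toReal := by
  have h1 := ae_le_eLpNormEssSup (f := f) (μ := volume.restrict (Ici t₀))
  have h2 := ae_le_eLpNormEssSup (f := k) (μ := volume.restrict (Ici t₀))
  rw [ae_restrict_iff' measurableSet_Ici] at h1 h2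
  filter_upwards [h1, h2] with t h1 h2 ht
  have h3 : ‖f t‖ₑ * ‖k t‖ₑ ≤ essNorm t₀ f * essNorm t₀ k := by
    simp only [essNorm, eLpNorm_exponent_top]
    exact mul_le_mul' (h1 ht) (h2 ht)
  have h4 := ENNReal.toReal_mono hfk h3
  rwa [ENNReal.toReal_mul, toReal_enorm, toReal_enorm, Real.norm_eq_abs, Real.norm_eq_abs] at h4

/-- The smallness condition in terms of the clock. If `b / (a - b)` is essentially unbounded, the
convention `0 · ∞ = 0` forces `∫_h^g (a - b) = 0`, that is `h = g`, almost everywhere. -/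
theorem exists_smallness_constants {a b h g : ℝ → ℝ} {r T₀ : ℝ} (hT₀ : 0 ≤ T₀) (hr : 0 ≤ r)
    (ha : MemLp a ∞ (volume.restrict (Ici 0))) (hb : MemLp b ∞ (volume.restrict (Ici 0)))
    (hab : ∀ t, 0 ≤ t → 0 ≤ b t ∧ b t ≤ a t)
    (hh : ∀ t, 0 ≤ t → t - r ≤ h t ∧ h t ≤ t) (hg : ∀ t, 0 ≤ t → t - r ≤ g t ∧ g t ≤ t)
    (hne : ∀ᵐ t ∂(volume.restrict (Ici (0 : ℝ))), a t - b t ≠ 0)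
    (hstar : essNorm T₀ (fun t => max (netIntegral a b (h t) t - 1 / Real.exp 1) 0)
        + 2 * essNorm T₀ (fun t => b t / (a t - b t))
            * essNorm T₀ (fun t => netIntegral a b (h t) (g t)) < 1) :
    ∃ A B β : ℝ, 0 ≤ A ∧ 0 ≤ B ∧ 0 ≤ β ∧ A + 2 * B < 1 ∧ ∀ᵐ t, T₀ + r ≤ t →
      delayClock a b t - delayClock a b (h t) - 1 / Real.exp 1 ≤ A ∧
      b t * |delayClock a b (h t) - delayClock a b (g t)| ≤ B * (a t - b t) ∧
      (b t ≤ β * (a t - b t) ∨ h t = g t) := by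
  set P := essNorm T₀ (fun t => max (netIntegral a b (h t) t - 1 / Real.exp 1) 0)
  set Q := essNorm T₀ (fun t => b t / (a t - b t)) with hQ
  set R := essNorm T₀ (fun t => netIntegral a b (h t) (g t)) with hR
  rw [mul_assoc] at hstar
  have hPtop : P ≠ ∞ := fun hcon => by simp [hcon] at hstar
  have hQRtop : Q * R ≠ ∞ := fun hcon => by simp [hcon] at hstar
  have hsum : P.toReal + 2 * (Q * R).toReal < 1 := by
    have h1 := (ENNReal.toReal_lt_toReal (hstar.trans ENNReal.one_lt_top).ne
      ENNReal.one_ne_top).2 hstar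
    rwa [ENNReal.toReal_add hPtop (ENNReal.mul_ne_top ENNReal.ofNat_ne_top hQRtop),
      ENNReal.toReal_mul, ENNReal.toReal_ofNat, ENNReal.toReal_one] at h1
  have hne' := hne
  rw [ae_restrict_iff' measurableSet_Ici] at hne
  have hlast : ∀ᵐ t, T₀ + r ≤ t → b t ≤ Q.toReal * (a t - b t) ∨ h t = g t := by
    by_cases hQtop : Q = ∞
    · have hR0 : R = 0 := by
        by_contra hcon
        exact hQRtop (by rw [hQtop, ENNReal.top_mul hcon])
      filter_upwards [ae_abs_eq_zero_of_essNorm hR0] with t ht htT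
      have h0 : 0 ≤ t := by linarith
      have hh0 : 0 ≤ h t := by linarith [(hh t h0).1]
      have hg0 : 0 ≤ g t := by linarith [(hg t h0).1]
      have h1 := ht (by linarith)
      rw [netIntegral_eq ha hb hh0 hg0] at h1
      right
      rcases lt_trichotomy (h t) (g t) with h2 | h2 | h2
      · linarith [delayClock_lt ha hb hab hne' hh0 h2]
      · exact h2
      · linarith [delayClock_lt ha hb hab hne' hg0 h2]
    · filter_upwards [ae_abs_le_toReal_essNorm hQtop, hne] with t ht hnet htT
      have h0 : 0 ≤ t := by linarith
      have hc : 0 < a t - b t :=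
        lt_of_le_of_ne (sub_nonneg.2 (hab t h0).2) (Ne.symm (hnet h0))
      left
      exact (div_le_iff₀ hc).1 ((le_abs_self _).trans (ht (by linarith)))
  refine ⟨P.toReal, (Q * R).toReal, Q.toReal, ENNReal.toReal_nonneg, ENNReal.toReal_nonneg,
    ENNReal.toReal_nonneg, hsum, ?_⟩
  filter_upwards [hlast, ae_abs_le_toReal_essNorm hPtop, ae_abs_mul_le_essNorm_mul hQRtop, hne]
    with t h1 h2 h3 hnet htT
  have h0 : 0 ≤ t := by linarith
  have hh0 : 0 ≤ h t := by linarith [(hh t h0).1]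
  have hg0 : 0 ≤ g t := by linarith [(hg t h0).1]
  have hc : 0 < a t - b t := lt_of_le_of_ne (sub_nonneg.2 (hab t h0).2) (Ne.symm (hnet h0))
  refine ⟨?_, ?_, h1 htT⟩
  · have := (le_max_left _ _).trans ((le_abs_self _).trans (h2 (by linarith)))
    rwa [netIntegral_eq ha hb hh0 h0] at this
  · have := h3 (by linarith)
    rw [netIntegral_eq ha hb hh0 hg0, abs_sub_comm, abs_of_nonneg (div_nonneg (hab t h0).1 hc.le),
      div_mul_eq_mul_div, div_le_iff₀ hc] at this
    exact this

/-! ### Stability -/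

/-- Exponential decay on the clock, uniformly in the initial point and the initial function. -/
theorem exists_clock_exponential_estimate {a b h g : ℝ → ℝ} {r T₀ : ℝ} (hT₀ : 0 ≤ T₀) (hr : 0 ≤ r)
    (ha : MemLp a ∞ (volume.restrict (Ici 0))) (hb : MemLp b ∞ (volume.restrict (Ici 0)))
    (hab : ∀ t, 0 ≤ t → 0 ≤ b t ∧ b t ≤ a t)
    (hh : ∀ t, 0 ≤ t → t - r ≤ h t ∧ h t ≤ t) (hg : ∀ t, 0 ≤ t → t - r ≤ g t ∧ g t ≤ t)
    (hne : ∀ᵐ t ∂(volume.restrict (Ici (0 : ℝ))), a t - b t ≠ 0)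
    (hinf : Tendsto (delayClock a b) atTop atTop)
    (hstar : essNorm T₀ (fun t => max (netIntegral a b (h t) t - 1 / Real.exp 1) 0)
        + 2 * essNorm T₀ (fun t => b t / (a t - b t))
            * essNorm T₀ (fun t => netIntegral a b (h t) (g t)) < 1) :
    ∃ M γ : ℝ, 0 < M ∧ 0 < γ ∧ ∀ t₀, 0 ≤ t₀ → ∀ φ x : ℝ → ℝ, IsInitialFunction r t₀ φ →
      IsDelaySolution a b h g r t₀ φ x → ∀ t, t₀ ≤ t →
        |x t| ≤ M * Real.exp (-γ * (delayClock a b t - delayClock a b t₀))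
          * initialSup r t₀ φ := by
  obtain ⟨α, hα0, hα⟩ : ∃ α : ℝ, 0 ≤ α ∧ ∀ᵐ t, 0 ≤ t → a t + b t ≤ α := by
    have hsum : essNorm 0 (a + b) ≠ ∞ := (ha.add hb).2.ne
    refine ⟨(essNorm 0 (a + b)).toReal, ENNReal.toReal_nonneg, ?_⟩
    filter_upwards [ae_abs_le_toReal_essNorm hsum] with t ht h0
    exact (le_abs_self _).trans (ht h0)
  set σ := delayClock a b
  set c := (Ici (0 : ℝ)).indicator (fun s => a s - b s)
  have hσ : IsClock σ c α := isClock_delayClock ha hb hab hα0 hα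
  obtain ⟨A, B, β, hA, hB, hβ, hAB, hae⟩ :=
    exists_smallness_constants hT₀ hr ha hb hab hh hg hne hstar
  obtain ⟨M, γ, hM, hγ, hdecay⟩ := ClockEquation.exists_exponential_decay hσ hinf hr hA hB hAB
  -- the factor by which a solution and its clock derivative can grow before the estimates apply
  set E := (1 + 2 * β) * Real.exp (α * (T₀ + 2 * r)) with hE
  have hEpos : 0 < E := by positivity
  have hden : 0 < 1 - (A + 2 * B) := by linarith
  have hAB0 : 0 ≤ A + 2 * B := by positivity
  refine ⟨M * Real.exp (γ * (α * (T₀ + r))) * (4 * E / (1 - (A + 2 * B))), γ, by positivity, hγ, ?_⟩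
  intro t₀ ht₀ φ x hφ hx
  have hgrow : ∀ t, t₀ ≤ t → |x t| ≤ initialSup r t₀ φ * Real.exp (α * (t - t₀)) := fun t ht =>
    hx.abs_le_exp ht₀ hr hab hα hα0 hh hg hφ ht
  set X := initialSup r t₀ φ
  have hX0 : 0 ≤ X := by
    have := (abs_nonneg _).trans (hgrow t₀ le_rfl)
    simpa using this
  set s₀ := max t₀ T₀
  have hs₀t : t₀ ≤ s₀ := le_max_left _ _
  have hs₀T : T₀ ≤ s₀ := le_max_right _ _
  have hs₀le : s₀ ≤ t₀ + T₀ := max_le (by linarith) (by linarith)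
  have hac : ∀ u v, t₀ ≤ u → u ≤ v → AbsolutelyContinuousOnInterval x u v := by
    intro u v hu huv
    refine (hx.absCont v (hu.trans huv)).mono ?_
    rw [uIcc_of_le huv, uIcc_of_le (hu.trans huv)]
    exact Icc_subset_Icc_left hu
  have heq := hx.equation
  rw [ae_restrict_iff' measurableSet_Ici] at heq
  have hclock : ClockEquation σ c b h g x r A B β (s₀ + r) := by
    filter_upwards [heq, hae] with t h1 h2 ht
    have h0 : 0 ≤ t := by linarith
    obtain ⟨x', hx', hxeq⟩ := h1 (show t₀ ≤ t by linarith)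
    obtain ⟨h3, h4, h5⟩ := h2 (by linarith)
    have hc : c t = a t - b t := indicator_of_mem (show t ∈ Ici (0 : ℝ) from h0) _
    rw [hc]
    refine ⟨?_, hh t h0, hg t h0, (hab t h0).1, h3, h4, h5⟩
    convert hx' using 1
    linarith
  have hY : ∀ t, t₀ ≤ t → t ≤ s₀ + r + r → |x t| ≤ X * Real.exp (α * (T₀ + 2 * r)) := by
    intro t h1 h2
    refine (hgrow t h1).trans (mul_le_mul_of_nonneg_left (Real.exp_le_exp.2 ?_) hX0)
    exact mul_le_mul_of_nonneg_left (by linarith) hα0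
  have hle1 : X * Real.exp (α * (T₀ + 2 * r)) ≤ E * X := by
    have := mul_nonneg hX0 (Real.exp_pos (α * (T₀ + 2 * r))).le
    rw [hE]
    nlinarith [mul_nonneg hβ this]
  have hL₀ : ClockLipschitzOn σ x (E * X) (Icc (s₀ + r) (s₀ + r + r)) := by
    refine hσ.clockLipschitzOn (hac _ _ (by linarith) (by linarith)) ?_
    filter_upwards [hclock.ae_abs_deriv_le hσ hβ (p := s₀) (q := s₀ + r) (S := s₀ + r + r)
      (Y := X * Real.exp (α * (T₀ + 2 * r))) le_rfl le_rfl
      (fun t ht => hY t (hs₀t.trans ht.1) ht.2)] with t ht htm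
    obtain ⟨x', h1, h2⟩ := ht htm
    exact ⟨x', h1, h2.trans (le_of_eq (by rw [hE]; ring))⟩
  obtain ⟨hb1, hb2⟩ := hclock.bounded hσ hr hA hB hβ hAB (p := s₀ + r) (by linarith)
    (by positivity) (fun S hS => hac _ _ (by linarith) hS)
    (fun t ht => (hY t (by linarith [ht.1]) ht.2).trans hle1) hL₀
  have hNeq : (2 * (E * X) + 2 * (E * X)) / (1 - (A + 2 * B))
      = 4 * E / (1 - (A + 2 * B)) * X := by ring
  rw [hNeq] at hb1 hb2
  intro t ht
  rcases le_total (s₀ + r) t with h1 | h1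
  · have e1 := hdecay hclock (by linarith) (fun S hS => hac _ _ (by linarith) hS) hb1 hb2 t h1
    refine e1.trans ?_
    have e2 : σ (s₀ + r) - σ t₀ ≤ α * (T₀ + r) :=
      (hσ.lip t₀ (s₀ + r) (by linarith)).trans
        (mul_le_mul_of_nonneg_left (by linarith) hα0)
    have e3 : Real.exp (-γ * (σ t - σ (s₀ + r)))
        ≤ Real.exp (γ * (α * (T₀ + r))) * Real.exp (-γ * (σ t - σ t₀)) := by
      rw [← Real.exp_add]
      exact Real.exp_le_exp.2 (by nlinarith)
    calc _ ≤ M * (Real.exp (γ * (α * (T₀ + r))) * Real.exp (-γ * (σ t - σ t₀)))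
          * (4 * E / (1 - (A + 2 * B)) * X) := by gcongr
      _ = _ := by ring
  · have e1 := (hY t ht (by linarith)).trans hle1
    have e2 : σ t - σ t₀ ≤ α * (T₀ + r) :=
      (hσ.lip t₀ t ht).trans (mul_le_mul_of_nonneg_left (by linarith) hα0)
    have e3 : 1 ≤ Real.exp (γ * (α * (T₀ + r))) * Real.exp (-γ * (σ t - σ t₀)) := by
      rw [← Real.exp_add]
      exact Real.one_le_exp (by nlinarith)
    have e4 : E ≤ 4 * E / (1 - (A + 2 * B)) := by
      rw [le_div_iff₀ hden]
      nlinarith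
    calc |x t| ≤ E * X := e1
      _ ≤ 1 * 1 * (4 * E / (1 - (A + 2 * B)) * X) := by nlinarith
      _ ≤ M * (Real.exp (γ * (α * (T₀ + r))) * Real.exp (-γ * (σ t - σ t₀)))
          * (4 * E / (1 - (A + 2 * B)) * X) := by gcongr
      _ = _ := by ring

/-- If the clock eventually advances by a definite amount over each time interval of length `T`,
then it grows at least linearly, uniformly in the starting point. -/
theorem linear_lower_bound_of_step {σ : ℝ → ℝ} (hσ : Monotone σ) {T κ t₁ : ℝ} (hT : 0 < T)
    (hκ : 0 ≤ κ) (ht₁ : 0 ≤ t₁) (h : ∀ t, t₁ ≤ t → κ ≤ σ (t + T) - σ t) :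
    ∀ t₀ t, 0 ≤ t₀ → t₀ ≤ t → κ / T * (t - t₀) - κ / T * (t₁ + T) ≤ σ t - σ t₀ := by
  intro t₀ t ht₀ ht
  have hκT : 0 ≤ κ / T := div_nonneg hκ hT.le
  have hiter : ∀ n : ℕ, ∀ u, t₁ ≤ u → n * κ ≤ σ (u + n * T) - σ u := by
    intro n
    induction n with
    | zero => intro u _; simp
    | succ n ih =>
      intro u hu
      have e1 := ih u hu
      have e2 := h (u + n * T) (by linarith [mul_nonneg n.cast_nonneg hT.le])
      push_cast
      rw [show u + (n + 1) * T = u + n * T + T by ring]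
      linarith
  set u := max t₀ t₁
  have hu0 : t₀ ≤ u := le_max_left _ _
  have hu1 : t₁ ≤ u := le_max_right _ _
  have hu2 : u ≤ t₀ + t₁ := max_le (by linarith) (by linarith)
  rcases le_total u t with hut | hut
  · set n := ⌊(t - u) / T⌋₊
    have hn1 : n * T ≤ t - u :=
      (le_div_iff₀ hT).1 (Nat.floor_le (div_nonneg (by linarith) hT.le))
    have hn2 : (t - u) / T ≤ n + 1 := (Nat.lt_floor_add_one _).le
    have e1 := hiter n u hu1
    have e2 : σ (u + n * T) ≤ σ t := hσ (by linarith)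
    have e3 := hσ hu0
    have e4 : κ / T * (t - u) ≤ (n + 1) * κ := by
      rw [div_mul_eq_mul_div, mul_div_assoc, mul_comm]
      exact mul_le_mul_of_nonneg_right hn2 hκ
    have e5 : κ / T * (u - t₀) ≤ κ / T * t₁ := mul_le_mul_of_nonneg_left (by linarith) hκT
    have e6 : κ / T * T = κ := div_mul_cancel₀ _ hT.ne'
    linarith
  · have e1 := hσ ht
    have e2 : κ / T * (t - t₀) ≤ κ / T * (t₁ + T) := mul_le_mul_of_nonneg_left (by linarith) hκT
    linarith

theorem theorem2 (a b h g : ℝ → ℝ) (τ δ : ℝ)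
    (ha : MemLp a ∞ (volume.restrict (Ici 0)))
    (hb : MemLp b ∞ (volume.restrict (Ici 0)))
    (hab : ∀ t, 0 ≤ t → 0 ≤ b t ∧ b t ≤ a t)
    (hh : AEMeasurable h (volume.restrict (Ici 0)))
    (hg : AEMeasurable g (volume.restrict (Ici 0)))
    (hτ : ∀ t, 0 ≤ t → 0 ≤ t - h t ∧ t - h t ≤ τ)
    (hδ : ∀ t, 0 ≤ t → 0 ≤ t - g t ∧ t - g t ≤ δ)
    (hne : ∀ᵐ t ∂(volume.restrict (Ici (0 : ℝ))), a t - b t ≠ 0)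
    (hinf : Tendsto (fun t : ℝ => ∫ s in (0 : ℝ)..t, (a s - b s)) atTop atTop)
    (hstar : ∃ t₀ : ℝ, 0 ≤ t₀ ∧
      essNorm t₀ (fun t => max (netIntegral a b (h t) t - 1 / Real.exp 1) 0)
        + 2 * essNorm t₀ (fun t => b t / (a t - b t))
            * essNorm t₀ (fun t => netIntegral a b (h t) (g t)) < 1) :
    AsymptoticallyStable a b h g (max δ τ) ∧
    ((∃ T : ℝ, 0 < T ∧
        0 < liminf (fun t : ℝ => ∫ s in t..(t + T), (a s - b s)) atTop) →
      UniformlyExponentiallyStable a b h g (max δ τ)) := by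

  obtain ⟨T₀, hT₀, hstar⟩ := hstar
  set r := max δ τ
  have hr : 0 ≤ r :=
    ((hδ 0 le_rfl).1.trans (hδ 0 le_rfl).2).trans (le_max_left _ _)
  have hh' : ∀ t, 0 ≤ t → t - r ≤ h t ∧ h t ≤ t := fun t ht => by
    have := le_max_right δ τ
    constructor <;> linarith [(hτ t ht).1, (hτ t ht).2]
  have hg' : ∀ t, 0 ≤ t → t - r ≤ g t ∧ g t ≤ t := fun t ht => by
    have := le_max_left δ τ
    constructor <;> linarith [(hδ t ht).1, (hδ t ht).2]
  have hσt : Tendsto (delayClock a b) atTop atTop :=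
    hinf.congr' ((eventually_ge_atTop 0).mono fun t ht => (delayClock_of_nonneg ht).symm)
  have hmono := monotone_delayClock ha hb hab
  obtain ⟨M, γ, hM, hγ, hest⟩ :=
    exists_clock_exponential_estimate hT₀ hr ha hb hab hh' hg' hne hσt hstar
  have hsup : ∀ t₀ φ, IsInitialFunction r t₀ φ → 0 ≤ initialSup r t₀ φ := fun t₀ φ hφ =>
    (abs_nonneg _).trans (hφ.abs_le_initialSup (t := t₀) ⟨by linarith, le_rfl⟩)
  refine ⟨fun t₀ ht₀ => ⟨fun ε hε => ⟨ε / M, div_pos hε hM, ?_⟩, ?_⟩, ?_⟩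
  · intro φ x hφ hx hη t ht
    have e1 : Real.exp (-γ * (delayClock a b t - delayClock a b t₀)) ≤ 1 :=
      Real.exp_le_one_iff.2 (by nlinarith [hmono ht])
    calc |x t| ≤ M * Real.exp (-γ * (delayClock a b t - delayClock a b t₀)) * initialSup r t₀ φ :=
          hest t₀ ht₀ φ x hφ hx t ht
      _ ≤ M * 1 * initialSup r t₀ φ := by
          have := hsup t₀ φ hφ
          gcongr
      _ < ε := by
          rw [lt_div_iff₀ hM] at hη
          linarith
  · intro φ x hφ hx
    have h1 : Tendsto (fun t => M * Real.exp (-γ * (delayClock a b t - delayClock a b t₀))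
        * initialSup r t₀ φ) atTop (𝓝 (M * 0 * initialSup r t₀ φ)) := by
      refine ((Real.tendsto_exp_atBot.comp ?_).const_mul M).mul_const _
      exact (tendsto_atTop_add_const_right _ _ hσt).const_mul_atTop_of_neg (by linarith)
    rw [mul_zero, zero_mul] at h1
    refine squeeze_zero_norm' ?_ h1
    filter_upwards [eventually_ge_atTop t₀] with t ht
    exact hest t₀ ht₀ φ x hφ hx t ht
  · rintro ⟨T, hT, hlim⟩
    obtain ⟨κ, hκ, hκlim⟩ := exists_between hlim
    have hbdd : IsBoundedUnder (· ≥ ·) atTop (fun t : ℝ => ∫ s in t..(t + T), (a s - b s)) := by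
      refine ⟨0, ?_⟩
      rw [eventually_map]
      filter_upwards [eventually_ge_atTop 0] with t ht
      exact intervalIntegral.integral_nonneg (by linarith)
        fun s hs => sub_nonneg.2 (hab s (ht.trans hs.1)).2
    obtain ⟨t₁, ht₁⟩ := eventually_atTop.1 (eventually_lt_of_lt_liminf hκlim hbdd)
    have hstep : ∀ t, max t₁ 0 ≤ t → κ ≤ delayClock a b (t + T) - delayClock a b t := by
      intro t ht
      have h0 : 0 ≤ t := (le_max_right _ _).trans ht
      rw [← integral_sub_eq_delayClock_sub ha hb h0 (by linarith)]
      exact (ht₁ t ((le_max_left _ _).trans ht)).le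
    have hlin := linear_lower_bound_of_step hmono hT hκ.le (le_max_right t₁ 0) hstep
    refine ⟨M * Real.exp (γ * (κ / T * (max t₁ 0 + T))), γ * (κ / T), by positivity, by positivity,
      ?_⟩
    intro t₀ ht₀ φ x hφ hx t ht
    refine (hest t₀ ht₀ φ x hφ hx t ht).trans (mul_le_mul_of_nonneg_right ?_ (hsup t₀ φ hφ))
    rw [mul_assoc, ← Real.exp_add]
    refine mul_le_mul_of_nonneg_left (Real.exp_le_exp.2 ?_) hM.le
    nlinarith [hlin t₀ t ht₀ ht]
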